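/- Let $\mathbb{CP}^3=\mathrm{Proj}\,\mathbb{C}[z^{\dot 1},z^{\dot 2},\pi_1,\pi_2]$, with homogeneous coordinates coming from the twistor correspondence $$\mathbb{C}^4\times\mathbb{CP}^1\to\mathbb{CP}^3,\qquad \big((x^{\alpha,\dot\alpha}),[\pi_1:\pi_2]\big)\mapsto[x^{\alpha,\dot 1}\pi_\alpha:x^{\alpha,\dot 2}\pi_\alpha:\pi_1:\pi_2]$$ (repeated indices are summed). Let $D=(D^{\alpha\dot\alpha,\beta\dot\beta})$ be a complex skew-symmetric $4\times4$ matrix, and let $\hat\Lambda$ be the $4\times 4$ matrix of polynomials, indexed by the homogeneous coordinates, whose $(z^{\dot\alpha},z^{\dot\beta})$ entry is $\hat\Lambda^{\dot\alpha\dot\beta}=D^{\alpha\dot\alpha,\beta\dot\beta}\pi_\alpha\pi_\beta$ and whose entries in the rows and columns of $\pi_1,\pi_2$ are $0$. With $\Lambda:=\hat\Lambda$ and a formal parameter $\mu$, let $$f\#g=\sum_{k\ge0}\frac1{k!}\Big(\frac\mu2\Big)^k\Lambda^{\alpha_1\beta_1}\cdots\Lambda^{\alpha_k\beta_k}\,(\partial_{\alpha_1}\cdots\partial_{\alpha_k}f)\,(\partial_{\beta_1}\cdots\partial_{\beta_k}g)$$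 for germs $f,g$ of sections of the sheaves $\mathcal O_{\mathbb{CP}^3}(d)$ (the formula is extended to formal sums of such germs times powers of $\mu$ whenever each coefficient is a finite sum; this is the case when $f$ is $A[Z]/\mu$ below). Let $\sum_{d=0}^\infty\mathcal O_{\mathbb{CP}^3}(d)$ denote the sheaf of formal, possibly infinite, sums of sections of the $\mathcal O_{\mathbb{CP}^3}(d)$, that is, $\prod_{d\ge0}\mathcal O_{\mathbb{CP}^3}(d)$, and let $V[\mu,\mu^{-1}]]$ denote the formal Laurent series with coefficients in $V$ and only finitely many positive powers of $\mu$. **Theorem.** Let $A[Z]$ be a homogeneous polynomial of degree $2$ in $z^{\dot1}=x^{\alpha,\dot1}\pi_\alpha$ and $z^{\dot2}=x^{\alpha,\dot2}\pi_\alpha$. Then the star exponentials $e_\#^{\frac t\mu A[Z]}$, $t\in\mathbb C$, and in particular $e_\#^{\frac1\mu A[Z]}$ (the case $t=1$), define cohomology classes of $\mathbb{CP}^3$ with coefficients in the sheaf $\sum_{d\ge0}\mathcal O_{\mathbb{CP}^3}(d)$. Precisely: at every point of $\mathbb{CP}^3$, each coefficient (for fixed degree $d$ and fixed power $\mu^m$)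 of the series $\sum_n\frac{t^n}{n!}\big(\tfrac1\mu A[Z]\big)^{\#n}$ has only finitely many nonzero terms, where $f^{\#0}=1$ and $f^{\#(n+1)}=f\#f^{\#n}$; there are classes $$E(t)\in H^0\Big(\mathbb{CP}^3,\sum_{d=0}^\infty\mathcal O_{\mathbb{CP}^3}(d)\Big)[\mu,\mu^{-1}]]\qquad(t\in\mathbb C)$$ whose germ at every point is the sum of that series; and $t\mapsto E(t)$ is the unique family of such classes that solves, coefficient by coefficient, the evolution equation $\partial_tE=\tfrac1\mu A[Z]\,\#\,E$, $E(0)=1$. -/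

import Mathlib

open CategoryTheory TopologicalSpace Opposite MvPolynomial

noncomputable section

namespace TwistorStar

/-! ### Extending a derivation to a localization -/

section LocDeriv

variable {A : Type} [CommRing A] [Algebra ℂ A] (M : Submonoid A)

/-- `a ↦ a/1 + ε (d a)/1`, into the dual numbers over the localization. -/
def dualHom (d : Derivation ℂ A A) : A →ₐ[ℂ] DualNumber (Localization M) where
  toFun a := TrivSqZeroExt.inl (algebraMap A (Localization M) a) +
    TrivSqZeroExt.inr (algebraMap A (Localization M) (d a))
  map_one' := by ext <;> simp
  map_zero' := by ext <;> simp
  map_add' a b := by ext <;> simp [Algebra.smul_def]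
  map_mul' a b := by
    ext
    · simp
    · simp
      rw [Algebra.smul_def, Algebra.smul_def]
      ring
  commutes' c := by
    ext
    · simp [TrivSqZeroExt.algebraMap_eq_inl', ← IsScalarTower.algebraMap_apply]
    · simp [TrivSqZeroExt.algebraMap_eq_inl']

theorem isUnit_dualHom (d : Derivation ℂ A A) (s : M) : IsUnit (dualHom M d s) := by
  rw [TrivSqZeroExt.isUnit_iff_isUnit_fst]
  simpa [dualHom] using IsLocalization.map_units (Localization M) s

/-- The extension of `dualHom` to the localization. -/
def dualLift (d : Derivation ℂ A A) : Localization M →ₐ[ℂ] DualNumber (Localization M) :=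
  IsLocalization.liftAlgHom (M := M) (f := dualHom M d) (isUnit_dualHom M d)

theorem dualLift_algebraMap (d : Derivation ℂ A A) (a : A) :
    dualLift M d (algebraMap A (Localization M) a) = dualHom M d a := by
  simp [dualLift]

theorem fst_dualLift (d : Derivation ℂ A A) (y : Localization M) : (dualLift M d y).fst = y := by
  have h : ((TrivSqZeroExt.fstHom (Localization M) (Localization M)
      (Localization M)).toRingHom.comp (dualLift M d).toRingHom) = RingHom.id _ := by
    apply IsLocalization.ringHom_ext M
    ext a
    simp [dualLift_algebraMap, dualHom]
  exact DFunLike.congr_fun h y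

/-- The unique extension of a derivation `d` of `A` to the localization `M⁻¹A`. -/
def locDeriv (d : Derivation ℂ A A) : Derivation ℂ (Localization M) (Localization M) where
  toFun y := (dualLift M d y).snd
  map_add' x y := by simp
  map_smul' c x := by simp
  map_one_eq_zero' := by simp
  leibniz' x y := by simp [fst_dualLift, mul_comm]

theorem locDeriv_algebraMap (d : Derivation ℂ A A) (a : A) :
    locDeriv M d (algebraMap A (Localization M) a) = algebraMap A (Localization M) (d a) := by
  change (dualLift M d _).snd = _
  simp only [dualLift_algebraMap, dualHom]
  simp
  rw [Algebra.smul_def, mul_one]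

end LocDeriv

/-! ### Projective three-space and the twisting sheaves -/

/-- Indices of the homogeneous coordinates `[z^1 : z^2 : π_1 : π_2]` of `ℂℙ³`:
`Sum.inl a` is the index of `z^a` and `Sum.inr α` is the index of `π_α`. -/
abbrev Idx : Type := Fin 2 ⊕ Fin 2

/-- The homogeneous coordinate ring `ℂ[z^1, z^2, π_1, π_2]` of `ℂℙ³`. -/
abbrev S : Type := MvPolynomial Idx ℂ

/-- The grading of the homogeneous coordinate ring by degree. -/
abbrev gr : ℕ → Submodule ℂ S := homogeneousSubmodule Idx ℂ

instance instGradedAlgebra : GradedAlgebra gr := MvPolynomial.gradedAlgebra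

/-- `ℂℙ³ = Proj ℂ[z^1, z^2, π_1, π_2]` with its Zariski topology. -/
abbrev CP3 : TopCat := ProjectiveSpectrum.top gr

/-- The elements of `S` not in the homogeneous prime ideal `x`. -/
abbrev away (x : ProjectiveSpectrum gr) : Submonoid S :=
  haveI := x.isPrime
  x.asHomogeneousIdeal.toIdeal.primeCompl

/-- The local ring of `S` at the homogeneous prime ideal `x`. The stalk at `x` of `𝒪(k)` is its
part of degree `k`, so this ring contains the germs of sections of all the `𝒪(k)`. -/
abbrev Germ (x : CP3) : Type := Localization (away x)

/-- A family of germs over `U` is a fraction `r / s` of homogeneous polynomials with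
`deg r = deg s + k`. -/
def IsFraction (k : ℕ) {U : Opens CP3} (f : ∀ x : U, Germ x.1) : Prop :=
  ∃ i j : ℕ, i = j + k ∧ ∃ r ∈ gr i, ∃ s ∈ gr j, ∀ x : U, ∃ h : s ∈ away x.1,
    f x = Localization.mk r ⟨s, h⟩

/-- Being locally a fraction of homogeneous polynomials with difference of degrees `k`. -/
def isLocallyFraction (k : ℕ) : TopCat.LocalPredicate fun x : CP3 => Germ x :=
  TopCat.PrelocalPredicate.sheafify
    { pred := fun f => IsFraction k f
      res := by
        rintro V U i f ⟨a, b, hab, r, hr, s, hs, h⟩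
        exact ⟨a, b, hab, r, hr, s, hs, fun x => h (i x)⟩ }

/-- The sections of `𝒪(k)` over `U`, as an additive group of families of germs. -/
def sections (k : ℕ) (U : Opens CP3) : AddSubgroup (∀ x : U, Germ x.1) where
  carrier := {f | (isLocallyFraction k).pred f}
  zero_mem' := by
    refine fun x => ⟨U, x.2, 𝟙 U, k, 0, (zero_add k).symm, 0, zero_mem _, 1,
      SetLike.GradedOne.one_mem, fun y => ⟨one_mem _, ?_⟩⟩
    simp [Localization.mk_zero]
  add_mem' := by
    intro f g hf hg x
    obtain ⟨V, hV, i, a, b, hab, r, hr, s, hs, h⟩ := hf x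
    obtain ⟨V', hV', i', a', b', hab', r', hr', s', hs', h'⟩ := hg x
    refine ⟨V ⊓ V', ⟨hV, hV'⟩, homOfLE (inf_le_left.trans i.le), a + b', b + b', by
      omega, s' * r + s * r', ?_, s * s', SetLike.mul_mem_graded hs hs', fun y => ?_⟩
    · refine add_mem ?_ ?_
      · rw [add_comm]
        exact SetLike.mul_mem_graded hs' hr
      · have : a + b' = b + a' := by omega
        rw [this]
        exact SetLike.mul_mem_graded hs hr'
    · obtain ⟨h1, e1⟩ := h ⟨y.1, y.2.1⟩
      obtain ⟨h2, e2⟩ := h' ⟨y.1, y.2.2⟩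
      refine ⟨mul_mem h1 h2, ?_⟩
      have := congrArg₂ (· + ·) e1 e2
      rw [Localization.add_mk] at this
      refine this.trans ?_
      congr 1
      ring
  neg_mem' := by
    intro f hf x
    obtain ⟨V, hV, i, a, b, hab, r, hr, s, hs, h⟩ := hf x
    refine ⟨V, hV, i, a, b, hab, -r, neg_mem hr, s, hs, fun y => ?_⟩
    obtain ⟨h1, e1⟩ := h y
    refine ⟨h1, ?_⟩
    rw [← Localization.neg_mk]
    exact congrArg Neg.neg e1

/-- The twisting sheaf `𝒪(k)`, as a presheaf of abelian groups. -/
def twistPresheaf (k : ℕ) : TopCat.Presheaf AddCommGrpCat.{0} CP3 where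
  obj U := AddCommGrpCat.of (sections k U.unop)
  map i := AddCommGrpCat.ofHom
    { toFun := fun s => ⟨fun x => s.1 (i.unop x), (isLocallyFraction k).res i.unop s.1 s.2⟩
      map_zero' := rfl
      map_add' := fun _ _ => rfl }

/-- Sheaves of abelian groups on `ℂℙ³`. -/
abbrev AbSheaf : Type 1 := Sheaf (Opens.grothendieckTopology CP3) AddCommGrpCat.{0}

/-- The twisting sheaf `𝒪(k)` of `ℂℙ³`. -/
def twist (k : ℕ) : AbSheaf :=
  ⟨twistPresheaf k, by
    refine (TopCat.Presheaf.isSheaf_iff_isSheaf_comp (forget AddCommGrpCat) _).mpr ?_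
    exact TopCat.Presheaf.isSheaf_of_iso
      (NatIso.ofComponents (fun _ => Iso.refl _) (by cat_disch) :
        (TopCat.subsheafToTypes (isLocallyFraction k)).1 ≅ twistPresheaf k ⋙ forget AddCommGrpCat)
      (TopCat.subsheafToTypes (isLocallyFraction k)).2⟩

/-- The sheaf `∑_{k ≥ 0} 𝒪(k)` of formal sums of sections of the `𝒪(k)`, `k ≥ 0`. -/
def sumTwist : AbSheaf :=
  ∏ᶜ fun k : ℕ => twist k

/-- The sheaf cohomology group `H⁰(ℂℙ³, F)`. -/
abbrev H0 (F : AbSheaf) : Type := Sheaf.H.{0} F 0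

/-! ### The twistor correspondence `ℂ⁴ × ℂℙ¹ → ℂℙ³` -/

/-- The polynomial ring in the coordinates `x^{α,a}` of `ℂ⁴` (the variables `Sum.inl (α, a)`) and
the homogeneous coordinates `π_α` of `ℂℙ¹` (the variables `Sum.inr α`). -/
abbrev CorrRing : Type := MvPolynomial ((Fin 2 × Fin 2) ⊕ Fin 2) ℂ

/-- The function `x^{α,a} π_α` (summed over `α`) on the correspondence space. -/
def incidence (a : Fin 2) : CorrRing :=
  ∑ α : Fin 2, X (Sum.inl (α, a)) * X (Sum.inr α)

/-- The pullback of polynomials in the homogeneous coordinates along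
`(x, [π_1 : π_2]) ↦ [x^{α,1} π_α : x^{α,2} π_α : π_1 : π_2]`. -/
def twistorPullback : S →ₐ[ℂ] CorrRing :=
  aeval (Sum.elim incidence fun α => X (Sum.inr α))

/-! ### The star product -/

/-- The matrix of the Poisson biderivation on `ℂℙ³`: its `(z^a, z^b)` entry is
`D^{αa,βb} π_α π_β` (summed over `α` and `β`) and all the other entries vanish. -/
def hatLambda (D : Matrix (Fin 2 × Fin 2) (Fin 2 × Fin 2) ℂ) : Matrix Idx Idx S :=
  Matrix.fromBlocks
    (Matrix.of fun a b => ∑ α : Fin 2, ∑ β : Fin 2,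
      C (D (α, a) (β, b)) * X (Sum.inr α) * X (Sum.inr β)) 0 0 0

/-- The partial derivative of germs with respect to the `i`-th homogeneous coordinate. -/
def germDeriv {x : CP3} (i : Idx) : Derivation ℂ (Germ x) (Germ x) :=
  locDeriv (away x) (pderiv i)

/-- The iterated partial derivative `∂_{i_1} ∂_{i_2} ⋯ ∂_{i_k} f`. -/
def iterDeriv {x : CP3} (l : List Idx) (f : Germ x) : Germ x :=
  l.foldr (fun i g => germDeriv i g) f

/-- The coefficient of `μ^k` in the star product of two germs:
`(1/k!) (1/2)^k Λ^{α_1β_1} ⋯ Λ^{α_kβ_k} ∂_{α_1} ⋯ ∂_{α_k} f ∂_{β_1} ⋯ ∂_{β_k} g`. -/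
def bidiff (Λ : Matrix Idx Idx S) {x : CP3} (k : ℕ) (f g : Germ x) : Germ x :=
  ((1 / (k.factorial : ℂ)) * (1 / 2) ^ k) • ∑ α : Fin k → Idx, ∑ β : Fin k → Idx,
    algebraMap S (Germ x) (∏ i, Λ (α i) (β i)) *
      iterDeriv (List.ofFn α) f * iterDeriv (List.ofFn β) g

/-- Formal sums `∑_{d ≥ 0} ∑_m f_{d,m} μ^m` of germs at `x`, where `f_{d,m}` stands for a germ of a
section of `𝒪(d)`. -/
abbrev FormalGerm (x : CP3) : Type := ℕ → ℤ → Germ x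

/-- The star product `f # g = ∑_k (1/k!) (μ/2)^k Λ^{α_1β_1} ⋯ ∂_{α_1} ⋯ f ∂_{β_1} ⋯ g` of formal
sums of germs. For fixed `(d, m)` the inner sum, over the power `k = r.1` of `μ` that comes from the
product and the power `r.2` of `μ` in `f`, has only finitely many nonzero terms
if the coefficients of `f` are polynomials, finitely many in each degree. -/
def star (Λ : Matrix Idx Idx S) {x : CP3} (f g : FormalGerm x) : FormalGerm x := fun d m =>
  ∑ p ∈ Finset.HasAntidiagonal.antidiagonal d, ∑ᶠ r : ℕ × ℤ,
    bidiff Λ r.1 (f p.1 r.2) (g p.2 (m - r.1 - r.2))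

/-- The constant `1`. -/
def formalOne (x : CP3) : FormalGerm x := fun d m => if d = 0 ∧ m = 0 then 1 else 0

/-- The formal germ of `A / μ`, for a homogeneous polynomial `A` of degree `2`. -/
def overMu (A : S) (x : CP3) : FormalGerm x := fun d m =>
  if d = 2 ∧ m = -1 then algebraMap S (Germ x) A else 0

/-- The powers with respect to the star product. -/
def starPow (Λ : Matrix Idx Idx S) {x : CP3} (f : FormalGerm x) : ℕ → FormalGerm x
  | 0 => formalOne x
  | n + 1 => star Λ f (starPow Λ f n)

/-- The star exponential series `∑_n (t^n / n!) f^{#n}`. -/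
def starExp (Λ : Matrix Idx Idx S) {x : CP3} (t : ℂ) (f : FormalGerm x) : FormalGerm x :=
  fun d m => ∑ᶠ n : ℕ, (t ^ n / (n.factorial : ℂ)) • starPow Λ f n d m

/-! ### Cohomology classes with coefficients in `∑_{k ≥ 0} 𝒪(k)` -/

/-- `H⁰(ℂℙ³, ∑_{k ≥ 0} 𝒪(k))[μ, μ⁻¹]]`: formal Laurent series, with finitely many positive powers
of `μ`, whose coefficients are cohomology classes. -/
abbrev ClassSeries : Type := {c : ℤ → H0 sumTwist // ∃ N : ℤ, ∀ m, N < m → c m = 0}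

/-- The value at `x` of the global section of `𝒪(k)` that corresponds to a cohomology class. -/
def classGerm {k : ℕ} (x : CP3) (c : H0 (twist k)) : Germ x :=
  (show sections k ⊤ from Sheaf.H.equiv₀ (twist k) Limits.isTerminalTop c).1 ⟨x, trivial⟩

/-- The formal germ at `x` of a series of cohomology classes. -/
def formalGerm (x : CP3) (c : ClassSeries) : FormalGerm x := fun d m =>
  classGerm x (Sheaf.H.map (Limits.Pi.π (fun k : ℕ => twist k) d) 0 (c.1 m))

/-- `E` solves the evolution equation `∂_t E = (A/μ) # E`, `E(0) = 1`. The derivative is taken in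
each coefficient, and tested against all linear functionals; on a curve in a finite-dimensional
space of germs it is the usual derivative. -/
def IsStarFlow (Λ : Matrix Idx Idx S) (A : S) (E : ℂ → ClassSeries) : Prop :=
  ∀ x : CP3, formalGerm x (E 0) = formalOne x ∧
    ∀ (t : ℂ) (d : ℕ) (m : ℤ) (φ : Germ x →ₗ[ℂ] ℂ),
      HasDerivAt (fun u => φ (formalGerm x (E u) d m))
        (φ (star Λ (overMu A x) (formalGerm x (E t)) d m)) t

end TwistorStar

end

/-! Both infinite sums collapse because of a bigrading by total degree and degree in `z`. Each
contraction with `Λ` differentiates twice and multiplies by a quadratic entry, so it preserves total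
degree. Only `z`-derivatives contribute and the entries of `Λ` involve only `π`, so each factor `μ`
costs two degrees in `z`. Since `A` is quadratic in `z`, the `n`-th star power of `A / μ` lies in
degree `2n`, and its coefficient of `μ^m` has `z`-degree `-2m`.

Hence degree `d` receives at most the term `n = d / 2`, and no positive power of `μ` occurs. All
coefficients are homogeneous polynomials, hence global sections, and a class in `H⁰` of the product
sheaf is a family of sections.

Left multiplication by `A / μ` raises degree by exactly `2`, so the evolution equation is triangular
in `d`. The exponential solves it by differentiating one monomial in `t`; uniqueness follows by
induction on `d` (`IsStarFlow.unique`). -/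

namespace TwistorStar

/-! ### Cohomology classes of the product of the twisting sheaves -/

section Product

variable {C : Type*} [Category C] {J : GrothendieckTopology C}
  [HasSheafify J AddCommGrpCat.{0}] [HasExt.{0} (Sheaf J AddCommGrpCat.{0})]
  {ι : Type*} (F : ι → Sheaf J AddCommGrpCat.{0}) [Limits.HasProduct F]

/-- Degree-zero `Ext` is a group of morphisms, so this and the next lemma are the universal property
of the product. -/
theorem H0_pi_ext {c c' : Sheaf.H.{0} (∏ᶜ F) 0}
    (h : ∀ i, Sheaf.H.map (Limits.Pi.π F i) 0 c = Sheaf.H.map (Limits.Pi.π F i) 0 c') :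
    c = c' := by
  apply Abelian.Ext.addEquiv₀.injective
  refine Limits.Pi.hom_ext _ _ fun i => ?_
  rw [← Sheaf.H.addEquiv₀_map, ← Sheaf.H.addEquiv₀_map, h]

theorem exists_H0_pi (c : ∀ i, Sheaf.H.{0} (F i) 0) :
    ∃ b : Sheaf.H.{0} (∏ᶜ F) 0, ∀ i, Sheaf.H.map (Limits.Pi.π F i) 0 b = c i := by
  refine ⟨Abelian.Ext.addEquiv₀.symm (Limits.Pi.lift fun i => Abelian.Ext.addEquiv₀ (c i)),
    fun i => ?_⟩
  apply Abelian.Ext.addEquiv₀.injective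
  rw [Sheaf.H.addEquiv₀_map, AddEquiv.apply_symm_apply, Limits.Pi.lift_π]

end Product

/-! ### Classes, global sections and their germs -/

theorem classGerm_injective {k : ℕ} {c c' : H0 (twist k)}
    (h : ∀ x, classGerm x c = classGerm x c') : c = c' := by
  apply (Sheaf.H.equiv₀ (twist k) Limits.isTerminalTop).injective
  exact Subtype.ext (funext fun x => h x.1)

theorem exists_classGerm_eq {k : ℕ} (s : sections k ⊤) :
    ∃ c : H0 (twist k), ∀ x, classGerm x c = s.1 ⟨x, trivial⟩ := by
  obtain ⟨c, hc⟩ := (Sheaf.H.equiv₀ (twist k) Limits.isTerminalTop).surjective s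
  exact ⟨c, fun x => congrArg (fun s : sections k ⊤ => s.1 ⟨x, trivial⟩) hc⟩

theorem classGerm_zero {k : ℕ} (x : CP3) : classGerm x (0 : H0 (twist k)) = 0 :=
  congrArg (fun s : sections k ⊤ => s.1 ⟨x, trivial⟩)
    (map_zero (Sheaf.H.equiv₀ (twist k) Limits.isTerminalTop))

theorem formalGerm_injective {c c' : ClassSeries}
    (h : ∀ x, formalGerm x c = formalGerm x c') : c = c' := by
  refine Subtype.ext (funext fun m => ?_)
  refine H0_pi_ext (fun k : ℕ => twist k) fun d => ?_
  refine classGerm_injective fun x => ?_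
  have := congrFun (congrFun (h x) d) m
  exact this

/-- A homogeneous polynomial of degree `d`, as a global section of `𝒪(d)`. -/
noncomputable def globalSection {d : ℕ} (p : S) (hp : p ∈ gr d) : sections d ⊤ :=
  ⟨fun x => algebraMap S (Germ x.1) p, fun _ => ⟨⊤, trivial, 𝟙 _, d, 0, (zero_add d).symm, p, hp, 1,
    SetLike.GradedOne.one_mem, fun _ => ⟨one_mem _, (Localization.mk_one_eq_algebraMap p).symm⟩⟩⟩

theorem exists_formalGerm_eq (f : ℕ → ℤ → S) (hf : ∀ d m, f d m ∈ gr d)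
    (h0 : ∀ d m, 0 < m → f d m = 0) :
    ∃ c : ClassSeries, ∀ x, formalGerm x c = fun d m => algebraMap S (Germ x) (f d m) := by
  choose c hc using fun d m => exists_classGerm_eq (globalSection (f d m) (hf d m))
  choose b hb using fun m => exists_H0_pi twist fun d => c d m
  refine ⟨⟨b, 0, fun m hm => H0_pi_ext twist fun d => ?_⟩, fun x => ?_⟩
  · refine (hb m d).trans (Eq.trans ?_ (map_zero _).symm)
    refine classGerm_injective fun x => (hc d m x).trans (Eq.trans ?_ (classGerm_zero x).symm)
    exact (congrArg _ (h0 d m hm)).trans (map_zero (algebraMap S (Germ x)))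
  · ext d m
    exact (congrArg (classGerm x) (hb m d)).trans (hc d m x)

/-! ### The star product of polynomials -/

/-- The iterated partial derivative of a polynomial. -/
noncomputable def polyIterDeriv (l : List Idx) (p : S) : S :=
  l.foldr (fun i q => pderiv i q) p

/-- The operators `bidiff` on polynomials. -/
noncomputable def polyBidiff (Λ : Matrix Idx Idx S) (k : ℕ) (p q : S) : S :=
  ((1 / (k.factorial : ℂ)) * (1 / 2) ^ k) • ∑ α : Fin k → Idx, ∑ β : Fin k → Idx,
    (∏ i, Λ (α i) (β i)) * polyIterDeriv (List.ofFn α) p * polyIterDeriv (List.ofFn β) q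

/-- The star product of formal sums of polynomials. -/
noncomputable def polyStar (Λ : Matrix Idx Idx S) (f g : ℕ → ℤ → S) : ℕ → ℤ → S := fun d m =>
  ∑ p ∈ Finset.HasAntidiagonal.antidiagonal d, ∑ᶠ r : ℕ × ℤ,
    polyBidiff Λ r.1 (f p.1 r.2) (g p.2 (m - r.1 - r.2))

/-- The powers of `A / μ` with respect to the star product of polynomials. -/
noncomputable def polyStarPow (Λ : Matrix Idx Idx S) (A : S) : ℕ → ℕ → ℤ → S
  | 0 => fun d m => if d = 0 ∧ m = 0 then 1 else 0
  | n + 1 => polyStar Λ (fun d m => if d = 2 ∧ m = -1 then A else 0) (polyStarPow Λ A n)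

theorem algebraMap_germ_injective (x : CP3) : Function.Injective (algebraMap S (Germ x)) :=
  haveI := x.isPrime
  IsLocalization.injective (Germ x)
    (Ideal.primeCompl_le_nonZeroDivisors x.asHomogeneousIdeal.toIdeal)

theorem iterDeriv_algebraMap (x : CP3) (l : List Idx) (p : S) :
    iterDeriv l (algebraMap S (Germ x) p) = algebraMap S (Germ x) (polyIterDeriv l p) := by
  induction l with
  | nil => rfl
  | cons i l ih =>
    change germDeriv i (iterDeriv l _) = _
    rw [ih]
    exact locDeriv_algebraMap _ _ _

theorem bidiff_algebraMap (Λ : Matrix Idx Idx S) (x : CP3) (k : ℕ) (p q : S) :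
    bidiff Λ k (algebraMap S (Germ x) p) (algebraMap S (Germ x) q) =
      algebraMap S (Germ x) (polyBidiff Λ k p q) := by
  simp only [bidiff, polyBidiff, iterDeriv_algebraMap, Algebra.smul_def, map_mul, map_sum,
    ← IsScalarTower.algebraMap_apply]

theorem star_algebraMap (Λ : Matrix Idx Idx S) (x : CP3) (f g : ℕ → ℤ → S) :
    star Λ (fun d m => algebraMap S (Germ x) (f d m)) (fun d m => algebraMap S (Germ x) (g d m)) =
      fun d m => algebraMap S (Germ x) (polyStar Λ f g d m) := by
  ext d m
  simp only [star, polyStar, bidiff_algebraMap, map_sum]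
  refine Finset.sum_congr rfl fun p _ => ?_
  -- Injectivity preserves the support, so no finiteness is needed to move the map through the
  -- `finsum`.
  exact ((algebraMap S (Germ x)).toAddMonoidHom.map_finsum_of_injective
    (algebraMap_germ_injective x) _).symm

theorem starPow_overMu (Λ : Matrix Idx Idx S) (A : S) (x : CP3) (n : ℕ) :
    starPow Λ (overMu A x) n = fun d m => algebraMap S (Germ x) (polyStarPow Λ A n d m) := by
  induction n with
  | zero =>
    ext d m
    simp only [starPow, formalOne, polyStarPow]
    split_ifs <;> simp
  | succ n ih =>
    have h : overMu A x =
        fun d m => algebraMap S (Germ x) (if d = 2 ∧ m = -1 then A else 0) := by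
      ext d m
      simp only [overMu]
      split_ifs <;> simp
    rw [starPow, ih, h, star_algebraMap]
    rfl

/-! ### The bigrading by total degree and by degree in `z` -/

/-- The weights of the homogeneous coordinates: the total degree and the degree in `z`. -/
def biweight : Idx → ℤ × ℤ := Sum.elim (fun _ => (1, 1)) fun _ => (1, 0)

/-- Weights are integers, so the subtraction is honest even when the derivative vanishes for lack of
degree. -/
theorem isWeightedHomogeneous_polyIterDeriv {w : ℤ × ℤ} {p : S}
    (hp : IsWeightedHomogeneous biweight p w) (l : List Idx) :
    IsWeightedHomogeneous biweight (polyIterDeriv l p) (w - (l.map biweight).sum) := by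
  induction l with
  | nil => simpa [TwistorStar.polyIterDeriv] using hp
  | cons i l ih =>
    refine ih.pderiv (i := i) ?_
    rw [List.map_cons, List.sum_cons]
    abel

theorem isWeightedHomogeneous_hatLambda (D : Matrix (Fin 2 × Fin 2) (Fin 2 × Fin 2) ℂ)
    (i j : Idx) :
    IsWeightedHomogeneous biweight (hatLambda D i j) (biweight i + biweight j - (0, 2)) := by
  rcases i with a | α <;> rcases j with b | β <;> simp only [hatLambda, Matrix.fromBlocks_apply₁₁,
    Matrix.fromBlocks_apply₁₂, Matrix.fromBlocks_apply₂₁, Matrix.fromBlocks_apply₂₂,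
    Matrix.zero_apply, isWeightedHomogeneous_zero, Matrix.of_apply]
  refine .sum _ _ _ fun α _ => .sum _ _ _ fun β _ => ?_
  exact ((isWeightedHomogeneous_X ℂ biweight (Sum.inr α)).C_mul _).mul
    (isWeightedHomogeneous_X ℂ biweight (Sum.inr β))

/-- The derivatives remove the weights of the indices and the entries of `Λ` restore them, up to
`(0, 2)` per contraction. -/
theorem isWeightedHomogeneous_polyBidiff {Λ : Matrix Idx Idx S}
    (hΛ : ∀ i j, IsWeightedHomogeneous biweight (Λ i j) (biweight i + biweight j - (0, 2)))
    (k : ℕ) {v w : ℤ × ℤ} {p q : S} (hp : IsWeightedHomogeneous biweight p v)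
    (hq : IsWeightedHomogeneous biweight q w) :
    IsWeightedHomogeneous biweight (polyBidiff Λ k p q) (v + w - k • (0, 2)) := by
  refine Submodule.smul_mem (weightedHomogeneousSubmodule ℂ biweight _) _ ?_
  refine IsWeightedHomogeneous.sum _ _ _ fun α _ => .sum _ _ _ fun β _ => ?_
  have := ((IsWeightedHomogeneous.prod Finset.univ (fun i => Λ (α i) (β i)) _
    fun i _ => hΛ (α i) (β i)).mul (isWeightedHomogeneous_polyIterDeriv hp (List.ofFn α))).mul
    (isWeightedHomogeneous_polyIterDeriv hq (List.ofFn β))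
  convert this using 1
  simp only [List.map_ofFn, List.sum_ofFn, Finset.sum_sub_distrib, Finset.sum_add_distrib,
    Finset.sum_const, Finset.card_univ, Fintype.card_fin, Function.comp_apply]
  abel

theorem isWeightedHomogeneous_polyStar {Λ : Matrix Idx Idx S}
    (hΛ : ∀ i j, IsWeightedHomogeneous biweight (Λ i j) (biweight i + biweight j - (0, 2)))
    {f g : ℕ → ℤ → S} (hf : ∀ d m, IsWeightedHomogeneous biweight (f d m) ((d : ℤ), -2 * m))
    (hg : ∀ d m, IsWeightedHomogeneous biweight (g d m) ((d : ℤ), -2 * m)) (d : ℕ) (m : ℤ) :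
    IsWeightedHomogeneous biweight (polyStar Λ f g d m) ((d : ℤ), -2 * m) := by
  refine IsWeightedHomogeneous.sum _ _ _ fun p hp => ?_
  -- The default value `0` of an infinite `finsum` is homogeneous of every weight, so finiteness
  -- plays no role.
  refine finsum_induction (fun q => IsWeightedHomogeneous biweight q ((d : ℤ), -2 * m))
    (isWeightedHomogeneous_zero ℂ _ _) (fun _ _ => .add) fun r => ?_
  convert isWeightedHomogeneous_polyBidiff hΛ r.1 (hf p.1 r.2) (hg p.2 (m - r.1 - r.2)) using 1
  have := Finset.HasAntidiagonal.mem_antidiagonal.mp hp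
  ext
  · simp [← this]
  · simp
    ring

theorem isWeightedHomogeneous_polyStarPow {Λ : Matrix Idx Idx S}
    (hΛ : ∀ i j, IsWeightedHomogeneous biweight (Λ i j) (biweight i + biweight j - (0, 2)))
    {A : S} (hA : IsWeightedHomogeneous biweight A (2, 2)) (n d : ℕ) (m : ℤ) :
    IsWeightedHomogeneous biweight (polyStarPow Λ A n d m) ((d : ℤ), -2 * m) := by
  induction n generalizing d m with
  | zero =>
    simp only [polyStarPow]
    split_ifs with h
    · obtain ⟨rfl, rfl⟩ := h
      exact isWeightedHomogeneous_one ℂ _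
    · exact isWeightedHomogeneous_zero ℂ _ _
  | succ n ih =>
    refine isWeightedHomogeneous_polyStar hΛ (fun d m => ?_) ih d m
    split_ifs with h
    · obtain ⟨rfl, rfl⟩ := h
      exact hA
    · exact isWeightedHomogeneous_zero ℂ _ _

theorem weight_biweight (s : Idx →₀ ℕ) :
    Finsupp.weight biweight s = ((s.degree : ℤ), (s (Sum.inl 0) + s (Sum.inl 1) : ℤ)) := by
  rw [Finsupp.weight_apply, Finsupp.sum_fintype _ _ (by simp), Finsupp.degree_eq_sum]
  simp [biweight, Fin.sum_univ_two]
  ext <;> simp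

theorem mem_gr_of_isWeightedHomogeneous {p : S} {d : ℕ} {w : ℤ}
    (hp : IsWeightedHomogeneous biweight p ((d : ℤ), w)) : p ∈ gr d := by
  rw [mem_homogeneousSubmodule, IsHomogeneous]
  intro s hs
  have := hp hs
  rw [weight_biweight, Prod.mk.injEq] at this
  refine (DFunLike.congr_fun Finsupp.degree_eq_weight_one s).symm.trans ?_
  exact_mod_cast this.1

theorem eq_zero_of_isWeightedHomogeneous_neg {p : S} {v w : ℤ}
    (hp : IsWeightedHomogeneous biweight p (v, w)) (hw : w < 0) : p = 0 := by
  ext s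
  by_contra hs
  have := hp hs
  rw [weight_biweight, Prod.mk.injEq] at this
  omega

/-! ### Polynomials in the twistor coordinates `z` -/

/-- Every point with `π_1 ≠ 0` is in the image of the correspondence: take `x^{1,a} = z^a / π_1` and
`x^{2,a} = 0`. So `π_1 p` vanishes at all points, hence as a polynomial. -/
theorem twistorPullback_injective : Function.Injective twistorPullback := by
  rw [injective_iff_map_eq_zero]
  intro p hp
  have h : X (Sum.inr 0) * p = 0 := by
    refine MvPolynomial.funext fun v => ?_
    rw [map_mul, eval_X, map_zero, mul_eq_zero, or_iff_not_imp_left]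
    intro hv
    let u : (Fin 2 × Fin 2) ⊕ Fin 2 → ℂ := Sum.elim
      (fun i => if i.1 = 0 then v (Sum.inl i.2) / v (Sum.inr 0) else 0) fun α => v (Sum.inr α)
    have hu : (aeval u).comp twistorPullback = aeval v := by
      refine algHom_ext fun i => ?_
      rcases i with b | α
      · simp [twistorPullback, incidence, u, hv]
      · simp [twistorPullback, u]
    have := congrArg (aeval u) hp
    rw [map_zero, ← AlgHom.comp_apply, hu] at this
    exact (RingHom.congr_fun (coe_aeval_eq_eval v) p).symm.trans this
  exact (mul_eq_zero.mp h).resolve_left (X_ne_zero _)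

theorem isWeightedHomogeneous_of_twistorPullback {A : S} {a : MvPolynomial (Fin 2) ℂ}
    (ha : a.IsHomogeneous 2) (hA : twistorPullback A = aeval incidence a) :
    IsWeightedHomogeneous biweight A (2, 2) := by
  have h : A = rename Sum.inl a := by
    apply twistorPullback_injective
    rw [hA, twistorPullback, aeval_rename]
    rfl
  subst h
  intro s hs
  obtain ⟨u, rfl, hu⟩ := coeff_rename_ne_zero _ _ _ hs
  have h2 : u.degree = 2 := (DFunLike.congr_fun Finsupp.degree_eq_weight_one u).trans (ha hu)
  rw [Finsupp.degree_eq_sum, Fin.sum_univ_two] at h2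
  rw [weight_biweight, Finsupp.degree_eq_sum, Fintype.sum_sum_type]
  simp [Fin.sum_univ_two, Finsupp.mapDomain_apply Sum.inl_injective, Finsupp.mapDomain_of_notMem_range]
  exact_mod_cast h2

/-! ### The evolution equation -/

theorem iterDeriv_smul {x : CP3} (l : List Idx) (c : ℂ) (f : Germ x) :
    iterDeriv l (c • f) = c • iterDeriv l f := by
  induction l with
  | nil => rfl
  | cons i l ih =>
    change germDeriv i (iterDeriv l _) = c • germDeriv i (iterDeriv l f)
    rw [ih, Derivation.map_smul]

theorem bidiff_zero_left (Λ : Matrix Idx Idx S) {x : CP3} (k : ℕ) (g : Germ x) :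
    bidiff Λ k 0 g = 0 := by
  have h (l : List Idx) : iterDeriv l (0 : Germ x) = 0 := by
    simpa using iterDeriv_smul l 0 (0 : Germ x)
  simp [bidiff, h]

theorem bidiff_smul_right (Λ : Matrix Idx Idx S) {x : CP3} (k : ℕ) (c : ℂ) (f g : Germ x) :
    bidiff Λ k f (c • g) = c • bidiff Λ k f g := by
  simp only [bidiff, iterDeriv_smul, mul_smul_comm, ← Finset.smul_sum]
  rw [smul_comm]

theorem star_smul_right (Λ : Matrix Idx Idx S) {x : CP3} (c : ℂ) (f g : FormalGerm x) (d : ℕ)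
    (m : ℤ) : star Λ f (fun d m => c • g d m) d m = c • star Λ f g d m := by
  simp only [star, bidiff_smul_right, Finset.smul_sum, smul_finsum]

/-- `A / μ` lives in degree `2` alone, so the product in degree `d` sees only degree `d - 2` of the
right factor. This is the triangularity behind both existence and uniqueness. -/
theorem star_overMu_congr (Λ : Matrix Idx Idx S) (A : S) {x : CP3} {g g' : FormalGerm x} {d : ℕ}
    (h : ∀ e, e + 2 = d → g e = g' e) (m : ℤ) :
    star Λ (overMu A x) g d m = star Λ (overMu A x) g' d m := by
  refine Finset.sum_congr rfl fun p hp => finsum_congr fun r => ?_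
  have hp' := Finset.HasAntidiagonal.mem_antidiagonal.mp hp
  by_cases h2 : p.1 = 2
  · rw [h p.2 (by omega)]
  · simp [overMu, h2, bidiff_zero_left]

theorem star_overMu_eq_zero (Λ : Matrix Idx Idx S) (A : S) {x : CP3} {g : FormalGerm x} {d : ℕ}
    (h : ∀ e, e + 2 = d → g e = 0) (m : ℤ) : star Λ (overMu A x) g d m = 0 := by
  rw [star_overMu_congr Λ A (g' := fun e n => (0 : ℂ) • g e n), star_smul_right, zero_smul]
  intro e he
  ext n
  simp [h e he]

theorem starPow_overMu_eq_zero (Λ : Matrix Idx Idx S) (A : S) (x : CP3) {n d : ℕ}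
    (h : d ≠ 2 * n) (m : ℤ) : starPow Λ (overMu A x) n d m = 0 := by
  induction n generalizing d m with
  | zero => simp [starPow, formalOne, show d ≠ 0 by omega]
  | succ n ih => exact star_overMu_eq_zero Λ A (fun e he => funext (ih (by omega))) m

/-- For odd `d` the surviving term is itself zero, so the formula needs no parity condition. -/
theorem starExp_overMu (Λ : Matrix Idx Idx S) (A : S) (x : CP3) (t : ℂ) :
    starExp Λ t (overMu A x) = fun d m =>
      (t ^ (d / 2) / ((d / 2).factorial : ℂ)) • starPow Λ (overMu A x) (d / 2) d m := by
  ext d m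
  refine finsum_eq_single _ _ fun n hn => ?_
  rw [starPow_overMu_eq_zero Λ A x (by omega), smul_zero]

theorem starExp_overMu_zero (Λ : Matrix Idx Idx S) (A : S) (x : CP3) :
    starExp Λ 0 (overMu A x) = formalOne x := by
  rw [starExp_overMu]
  ext d m
  rcases Nat.eq_zero_or_pos (d / 2) with h | h
  · simp [h, starPow]
  · simp [h.ne', formalOne, show d ≠ 0 by omega]

theorem hasDerivAt_starExp_overMu (Λ : Matrix Idx Idx S) (A : S) (x : CP3) (t : ℂ) (d : ℕ)
    (m : ℤ) (φ : Germ x →ₗ[ℂ] ℂ) :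
    HasDerivAt (fun u => φ (starExp Λ u (overMu A x) d m))
      (φ (star Λ (overMu A x) (starExp Λ t (overMu A x)) d m)) t := by
  simp only [starExp_overMu, map_smul, smul_eq_mul]
  rcases lt_or_ge d 2 with hd | hd
  · rw [star_overMu_eq_zero Λ A (fun e he => by omega), map_zero]
    simpa [show d / 2 = 0 by omega] using hasDerivAt_const t _
  · obtain ⟨e, rfl⟩ := Nat.exists_eq_add_of_le' hd
    -- The scalar depends on the degree; freezing it at its value in degree `e`, the only one that
    -- matters, makes it a constant that can be pulled out.
    rw [star_overMu_congr Λ A (g' := fun f n => (t ^ (e / 2) / ((e / 2).factorial : ℂ)) •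
      starPow Λ (overMu A x) (e / 2) f n), star_smul_right, map_smul, smul_eq_mul]
    · rw [show (e + 2) / 2 = e / 2 + 1 by omega]
      refine (((hasDerivAt_pow (e / 2 + 1) t).div_const _).mul_const _).congr_deriv ?_
      rw [Nat.factorial_succ, Nat.add_sub_cancel, Nat.cast_mul,
        mul_div_mul_left _ _ (Nat.cast_ne_zero.mpr (Nat.succ_ne_zero _))]
      rfl
    · intro f hf
      obtain rfl : f = e := by omega
      rfl

/-- Once the lower degrees agree for all times, the difference in degree `d` has zero derivative
under every functional and vanishes at `t = 0`. Functionals separate the germs. -/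
theorem IsStarFlow.unique {Λ : Matrix Idx Idx S} {A : S} {E E' : ℂ → ClassSeries}
    (hE : IsStarFlow Λ A E) (hE' : IsStarFlow Λ A E') : E = E' := by
  refine funext fun t => formalGerm_injective fun x => funext fun d => ?_
  induction d using Nat.strong_induction_on generalizing t with
  | _ d ih =>
    ext m
    rw [← sub_eq_zero, ← Module.forall_dual_apply_eq_zero_iff ℂ]
    intro φ
    have h (u : ℂ) : HasDerivAt (fun u => φ (formalGerm x (E u) d m) - φ (formalGerm x (E' u) d m))
        0 u := by
      have := ((hE x).2 u d m φ).sub ((hE' x).2 u d m φ)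
      rwa [star_overMu_congr Λ A (fun e he => ih e (by omega) u), sub_self] at this
    have h0 := is_const_of_deriv_eq_zero (fun u => (h u).differentiableAt) (fun u => (h u).deriv) t 0
    rwa [(hE x).1, (hE' x).1, sub_self, ← map_sub] at h0

theorem exists_formalGerm_eq_starExp (D : Matrix (Fin 2 × Fin 2) (Fin 2 × Fin 2) ℂ) {A : S}
    (hA : IsWeightedHomogeneous biweight A (2, 2)) (t : ℂ) :
    ∃ c : ClassSeries, ∀ x, formalGerm x c = starExp (hatLambda D) t (overMu A x) := by
  have hw := isWeightedHomogeneous_polyStarPow (isWeightedHomogeneous_hatLambda D) hA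
  obtain ⟨c, hc⟩ := exists_formalGerm_eq
    (fun d m => (t ^ (d / 2) / ((d / 2).factorial : ℂ)) • polyStarPow (hatLambda D) A (d / 2) d m)
    (fun d m => Submodule.smul_mem _ _ (mem_gr_of_isWeightedHomogeneous (hw _ d m)))
    (fun d m hm => by rw [eq_zero_of_isWeightedHomogeneous_neg (hw _ d m) (by omega), smul_zero])
  refine ⟨c, fun x => ?_⟩
  rw [hc, starExp_overMu]
  ext d m
  rw [starPow_overMu, Algebra.smul_def, Algebra.smul_def, map_mul,
    ← IsScalarTower.algebraMap_apply]

end TwistorStar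

theorem mainTheorem4
    (D : Matrix (Fin 2 × Fin 2) (Fin 2 × Fin 2) ℂ) (hD : D.transpose = -D)
    (A : TwistorStar.S) (a : MvPolynomial (Fin 2) ℂ) (ha : a.IsHomogeneous 2)
    (hA : TwistorStar.twistorPullback A = MvPolynomial.aeval TwistorStar.incidence a) :
    (∀ (x : TwistorStar.CP3) (d : ℕ) (m : ℤ), {n : ℕ | TwistorStar.starPow
        (TwistorStar.hatLambda D) (TwistorStar.overMu A x) n d m ≠ 0}.Finite) ∧
    ∃ E : ℂ → TwistorStar.ClassSeries,
      (∀ (t : ℂ) (x : TwistorStar.CP3), TwistorStar.formalGerm x (E t) =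
        TwistorStar.starExp (TwistorStar.hatLambda D) t (TwistorStar.overMu A x)) ∧
      TwistorStar.IsStarFlow (TwistorStar.hatLambda D) A E ∧
      ∀ E' : ℂ → TwistorStar.ClassSeries,
        TwistorStar.IsStarFlow (TwistorStar.hatLambda D) A E' → E' = E := by
  have hw := TwistorStar.isWeightedHomogeneous_of_twistorPullback ha hA
  refine ⟨fun x d m => (Set.finite_singleton (d / 2)).subset fun n hn => ?_, ?_⟩
  · by_contra hne
    rw [Set.mem_singleton_iff] at hne
    exact hn (TwistorStar.starPow_overMu_eq_zero _ A x (by omega) m)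
  choose E hE using TwistorStar.exists_formalGerm_eq_starExp D hw
  have hflow : TwistorStar.IsStarFlow (TwistorStar.hatLambda D) A E := fun x => by
    simp only [hE]
    exact ⟨TwistorStar.starExp_overMu_zero _ A x,
      TwistorStar.hasDerivAt_starExp_overMu _ A x⟩
  exact ⟨E, hE, hflow, fun E' hE' => hE'.unique hflow⟩
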